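/- Let $G$ be a finite simple connected graph with at least two vertices and $m$ edges. A path in an edge-colored graph is a rainbow path if no two of its edges have the same color, and a rainbow $u$–$v$ geodesic is a rainbow $u$–$v$ path of length $d(u,v)$. The strong rainbow connection number $src(G)$ is the smallest number of colors in an edge-coloring of $G$ (adjacent edges may share a color) for which every two vertices $u,v$ are joined by a rainbow $u$–$v$ geodesic. A block of $G$ is a maximal connected subgraph without a cut vertex. For $t \ge 0$ let $\overline{\mathcal{G}}_t$ be the class of connected graphs $G$ such that (i) each block of $G$ is a bridge (cut edge) or a triangle, (ii) $G$ contains exactly $t$ triangles, and (iii) each triangle of $G$ contains at least one vertex of degree two in $G$. If $G$ contains $t$ pairwise edge-disjoint triangles, then $$src(G) \le m - 2t,$$ and equality holds if and only if $G \in \overline{\mathcal{G}}_t$. -/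

import Mathlib

namespace SimpleGraph

variable {V : Type*} {G : SimpleGraph V}

/-- A walk is a rainbow path under the edge-coloring `c` if it is a path no two edges of which
have the same color. -/
def Walk.IsRainbowPath {K : Type*} (c : G.edgeSet → K) {u v : V} (p : G.Walk u v) : Prop :=
  p.IsPath ∧ ∀ e f : G.edgeSet, e.1 ∈ p.edges → f.1 ∈ p.edges → c e = c f → e = f

/-- `c` is a strong rainbow coloring of `G`: any two vertices `u`, `v` are joined by a rainbow
geodesic, that is, by a rainbow path of length `d(u, v)`. -/
def IsStrongRainbowColoring (G : SimpleGraph V) {K : Type*} (c : G.edgeSet → K) : Prop :=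
  ∀ u v : V, ∃ p : G.Walk u v, p.IsRainbowPath c ∧ p.length = G.dist u v

/-- The strong rainbow connection number of a (connected) graph: the least number of colors
in a strong rainbow coloring. -/
noncomputable def src (G : SimpleGraph V) : ℕ :=
  sInf {k : ℕ | ∃ c : G.edgeSet → Fin k, G.IsStrongRainbowColoring c}

/-- On a finite connected graph the set in the definition of `src` is nonempty: give the edges
pairwise distinct colors. -/
theorem exists_isStrongRainbowColoring [Finite V] (hG : G.Connected) :
    {k : ℕ | ∃ c : G.edgeSet → Fin k, G.IsStrongRainbowColoring c}.Nonempty := by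
  obtain ⟨k, ⟨e⟩⟩ := Finite.exists_equiv_fin G.edgeSet
  refine ⟨k, e, fun u v => ?_⟩
  obtain ⟨p, hp, hl⟩ := hG.exists_path_of_dist u v
  exact ⟨p, ⟨hp, fun a b _ _ h => e.injective h⟩, hl⟩

/-- The edges of `G` with both ends in `s`; for a triangle with vertex set `s`, its three edges. -/
def edgesWithin (G : SimpleGraph V) (s : Finset V) : Set (Sym2 V) :=
  {e | e ∈ G.edgeSet ∧ ∀ v ∈ e, v ∈ s}

/-- `G` contains `t` (pairwise) edge-disjoint triangles. -/
def HasEdgeDisjointTriangles (G : SimpleGraph V) (t : ℕ) : Prop :=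
  ∃ T : Finset (Finset V), T.card = t ∧ (∀ s ∈ T, G.IsNClique 3 s) ∧
    (T : Set (Finset V)).PairwiseDisjoint G.edgesWithin

/-- `v` is a cut vertex of the connected subgraph `H`: deleting `v` disconnects `H`. -/
def Subgraph.IsCutVertex (H : G.Subgraph) (v : V) : Prop :=
  v ∈ H.verts ∧ ¬ (H.deleteVerts {v}).Preconnected

/-- A block of `G`: a maximal connected subgraph without a cut vertex. -/
def Subgraph.IsBlock (B : G.Subgraph) : Prop :=
  Maximal (fun H : G.Subgraph => H.Connected ∧ ∀ v, ¬ H.IsCutVertex v) B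

/-- The subgraph `B` consists of a bridge (cut edge) of `G` and its two ends. -/
def Subgraph.IsBridgeSubgraph (B : G.Subgraph) : Prop :=
  ∃ (u v : V) (h : G.Adj u v), G.IsBridge s(u, v) ∧ B = G.subgraphOfAdj h

/-- The subgraph `B` is a triangle of `G`. -/
def Subgraph.IsTriangleSubgraph (B : G.Subgraph) : Prop :=
  ∃ s : Finset V, G.IsNClique 3 s ∧ B = (⊤ : G.Subgraph).induce s

/-- The class of connected graphs all of whose blocks are bridges or triangles, that contain
exactly `t` triangles, and in which every triangle has a vertex of degree two in the graph. -/
structure InTriangleTreeClass [Fintype V] [DecidableEq V] (G : SimpleGraph V)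
    [DecidableRel G.Adj] (t : ℕ) : Prop where
  connected : G.Connected
  blocks : ∀ B : G.Subgraph, B.IsBlock → B.IsBridgeSubgraph ∨ B.IsTriangleSubgraph
  card_triangles : (G.cliqueFinset 3).card = t
  degree_two : ∀ s ∈ G.cliqueFinset 3, ∃ v ∈ s, G.degree v = 2

end SimpleGraph

/-! The disjoint triangles and the remaining single edges form an `EdgeCliquePartition` with m - 2t
cliques. Two distinct edges of a geodesic have ends at distance at least 2, so edges of one clique
never share a geodesic. Coloring every edge by its clique is therefore strongly rainbow, which is
the bound (`src_le`).

If equality holds, no recoloring can save a color. One is saved when all three vertices of a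
triangle of the partition have neighbors outside it (`src_lt_of_adj_notMem`), when some triangle is
not in the partition (`src_lt_of_triangle`), or when two edges lie opposite each other on a cycle
without shortcuts (`src_lt_of_opposite_edges`). Excluding the last case restricts how consecutive
distance levels are joined (`not_opposite_config`), and the blocks can be read off from the levels
(`isBlock_bridge_or_triangle`).

Conversely, in a graph of the class pick a vertex of degree two in each triangle and delete the at
most 2t edges at these vertices. A forest remains, and it contains all geodesics between the other
vertices. Any two of its edges lie on the unique path between their farthest ends, so its at least m
- 2t edges have distinct colors (`ne_of_isAcyclic_deleteEdges`, `card_edgeFinset_le`). -/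

namespace SimpleGraph

variable {V : Type*} {G : SimpleGraph V}

/-! ### Geodesics and pairs of edges on them -/

/-- Two edges `ab`, `cd` such that `d(a, d) = d(b, c) + 2` for suitable names of their ends. This
is the case if they are distinct edges of some geodesic. -/
def GeodesicPair (G : SimpleGraph V) (e f : Sym2 V) : Prop :=
  ∃ a b c d, e = s(a, b) ∧ f = s(c, d) ∧ G.dist a d = G.dist b c + 2

theorem geodesicPair_mk_iff {a b c d : V} :
    G.GeodesicPair s(a, b) s(c, d) ↔
      G.dist a d = G.dist b c + 2 ∨ G.dist a c = G.dist b d + 2 ∨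
        G.dist b d = G.dist a c + 2 ∨ G.dist b c = G.dist a d + 2 := by
  constructor
  · rintro ⟨a', b', c', d', h1, h2, h⟩
    rw [Sym2.eq_iff] at h1 h2
    rcases h1 with ⟨rfl, rfl⟩ | ⟨rfl, rfl⟩ <;> rcases h2 with ⟨rfl, rfl⟩ | ⟨rfl, rfl⟩ <;> tauto
  · rintro (h | h | h | h)
    · exact ⟨a, b, c, d, rfl, rfl, h⟩
    · exact ⟨a, b, d, c, rfl, Sym2.eq_swap, h⟩
    · exact ⟨b, a, c, d, Sym2.eq_swap, rfl, h⟩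
    · exact ⟨b, a, d, c, Sym2.eq_swap, Sym2.eq_swap, h⟩

theorem GeodesicPair.symm {e f : Sym2 V} (h : G.GeodesicPair e f) : G.GeodesicPair f e := by
  induction e with | _ a b => induction f with | _ c d =>
  rw [geodesicPair_mk_iff] at h ⊢
  rw [G.dist_comm (u := c) (v := b), G.dist_comm (u := c) (v := a), G.dist_comm (u := d) (v := b),
    G.dist_comm (u := d) (v := a)]
  tauto

/-- The three segments of the walk bound three distances from above; by the triangle inequality
these must add up to the full length, so each bound is attained. -/
theorem Walk.dist_getVert_of_length_eq_dist (hG : G.Connected) {u v : V} (p : G.Walk u v)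
    (hp : p.length = G.dist u v) {i j : ℕ} (hij : i ≤ j) (hj : j ≤ p.length) :
    G.dist (p.getVert i) (p.getVert j) = j - i := by
  have h1 : G.dist u (p.getVert i) ≤ i := (dist_le (p.take i)).trans (by simp)
  have h2 : G.dist (p.getVert j) v ≤ p.length - j := (dist_le (p.drop j)).trans (by simp)
  have h3 : G.dist (p.getVert i) (p.getVert j) ≤ j - i := by
    have := dist_le (((p.drop i).take (j - i)).copy rfl
      (by rw [Walk.drop_getVert]; congr 1; omega : (p.drop i).getVert (j - i) = p.getVert j))
    refine this.trans ?_
    simp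
  have h4 := hG.dist_triangle (u := u) (v := p.getVert i) (w := v)
  have h5 := hG.dist_triangle (u := p.getVert i) (v := p.getVert j) (w := v)
  omega

theorem Walk.exists_eq_mk_of_mem_edges {u v : V} (p : G.Walk u v) {e : Sym2 V} (he : e ∈ p.edges) :
    ∃ i < p.length, e = s(p.getVert i, p.getVert (i + 1)) := by
  induction p with
  | nil => simp at he
  | cons h q ih =>
    rw [Walk.edges_cons, List.mem_cons] at he
    rcases he with rfl | he
    · exact ⟨0, by simp, by simp⟩
    · obtain ⟨i, hi, rfl⟩ := ih he
      exact ⟨i + 1, by simpa using hi, by simp⟩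

theorem Walk.geodesicPair_of_mem_edges (hG : G.Connected) {u v : V} (p : G.Walk u v)
    (hp : p.length = G.dist u v) {e f : Sym2 V} (he : e ∈ p.edges) (hf : f ∈ p.edges)
    (hef : e ≠ f) : G.GeodesicPair e f := by
  obtain ⟨i, hi, rfl⟩ := p.exists_eq_mk_of_mem_edges he
  obtain ⟨j, hj, rfl⟩ := p.exists_eq_mk_of_mem_edges hf
  have key : ∀ i j, i < j → j < p.length →
      G.GeodesicPair s(p.getVert i, p.getVert (i + 1)) s(p.getVert j, p.getVert (j + 1)) := by
    intro i j hij hj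
    refine ⟨_, _, _, _, rfl, rfl, ?_⟩
    rw [p.dist_getVert_of_length_eq_dist hG hp (by omega) (by omega),
      p.dist_getVert_of_length_eq_dist hG hp (by omega) (by omega)]
    omega
  rcases lt_trichotomy i j with h | rfl | h
  · exact key i j h hj
  · exact absurd rfl hef
  · exact (key j i h hi).symm

theorem Walk.exists_dist_of_mem_edges (hG : G.Connected) {u v : V} (p : G.Walk u v)
    (hp : p.length = G.dist u v) {e : Sym2 V} (he : e ∈ p.edges) :
    ∃ a b, e = s(a, b) ∧ G.dist u a + 1 + G.dist b v = G.dist u v := by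
  obtain ⟨i, hi, rfl⟩ := p.exists_eq_mk_of_mem_edges he
  refine ⟨_, _, rfl, ?_⟩
  have h1 := p.dist_getVert_of_length_eq_dist hG hp (Nat.zero_le i) hi.le
  have h2 := p.dist_getVert_of_length_eq_dist hG hp (show i + 1 ≤ _ from hi) le_rfl
  simp only [Walk.getVert_zero, Walk.getVert_length] at h1 h2
  omega

theorem Connected.exists_adj_dist_add_one (hG : G.Connected) {u v : V} (h : u ≠ v) :
    ∃ w, G.Adj u w ∧ G.dist w v + 1 = G.dist u v := by
  obtain ⟨p, hp⟩ := hG.exists_walk_length_eq_dist u v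
  cases p with
  | nil => exact absurd rfl h
  | @cons _ w _ hw q =>
    refine ⟨w, hw, ?_⟩
    have h1 := dist_le q
    have h2 := hG.dist_triangle (u := u) (v := w) (w := v)
    rw [dist_eq_one_iff_adj.2 hw] at h2
    simp only [Walk.length_cons] at hp
    omega

theorem Connected.dist_le_dist_add_one (hG : G.Connected) {u v w : V} (h : G.Adj v w) :
    G.dist u v ≤ G.dist u w + 1 := by
  have := hG.dist_triangle (u := u) (v := w) (w := v)
  rwa [dist_eq_one_iff_adj.2 h.symm] at this

theorem Connected.dist_le_dist_add_one' (hG : G.Connected) {u v w : V} (h : G.Adj v w) :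
    G.dist v u ≤ G.dist w u + 1 := by
  rw [dist_comm, G.dist_comm (u := w)]
  exact hG.dist_le_dist_add_one h

/-- A coloring with colors from a finite set `S` bounds the strong rainbow connection number. -/
theorem src_le_card [Fintype V] {α : Type*} (S : Finset α) (κ : Sym2 V → α)
    (hS : ∀ e ∈ G.edgeSet, κ e ∈ S)
    (h : ∀ u v : V, ∃ p : G.Walk u v, p.length = G.dist u v ∧
      ∀ e ∈ p.edges, ∀ f ∈ p.edges, κ e = κ f → e = f) : G.src ≤ S.card := by
  refine Nat.sInf_le ⟨fun e => S.equivFin ⟨κ e.1, hS e.1 e.2⟩, fun u v => ?_⟩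
  obtain ⟨p, hp, hr⟩ := h u v
  refine ⟨p, ⟨p.isPath_of_length_eq_dist hp, fun e f he hf hef => ?_⟩, hp⟩
  have := S.equivFin.injective hef
  exact Subtype.ext (hr _ he _ hf (by simpa using this))

/-- Here every geodesic is rainbow, so checking a coloring reduces to arithmetic with distances
between ends of edges. -/
theorem Connected.src_le_card_of_not_geodesicPair [Fintype V] (hG : G.Connected) {α : Type*}
    (S : Finset α) (κ : Sym2 V → α) (hS : ∀ e ∈ G.edgeSet, κ e ∈ S)
    (h : ∀ e ∈ G.edgeSet, ∀ f ∈ G.edgeSet, κ e = κ f → ¬ G.GeodesicPair e f) :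
    G.src ≤ S.card := by
  refine src_le_card S κ hS fun u v => ?_
  obtain ⟨p, hp⟩ := hG.exists_walk_length_eq_dist u v
  refine ⟨p, hp, fun e he f hf hef => ?_⟩
  by_contra hne
  exact h e (p.edges_subset_edgeSet he) f (p.edges_subset_edgeSet hf) hef
    (p.geodesicPair_of_mem_edges hG hp he hf hne)

/-! ### Coloring edges by the cliques of a partition -/

/-- A family of cliques of `G` such that every edge `e` lies in exactly one of them, `part e`. -/
structure EdgeCliquePartition (G : SimpleGraph V) where
  /-- The cliques of the partition. -/
  cliques : Finset (Finset V)
  /-- The clique of the partition that contains a given edge. -/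
  part : Sym2 V → Finset V
  isClique : ∀ K ∈ cliques, G.IsClique K
  part_mem : ∀ e ∈ G.edgeSet, part e ∈ cliques
  mem_part : ∀ e ∈ G.edgeSet, ∀ v ∈ e, v ∈ part e
  part_eq : ∀ K ∈ cliques, ∀ u ∈ K, ∀ v ∈ K, u ≠ v → part s(u, v) = K

namespace EdgeCliquePartition

variable (P : G.EdgeCliquePartition) {K L : Finset V}

theorem mem_part_left {u v : V} (h : G.Adj u v) : u ∈ P.part s(u, v) :=
  P.mem_part _ h _ (Sym2.mem_mk_left u v)

theorem mem_part_right {u v : V} (h : G.Adj u v) : v ∈ P.part s(u, v) :=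
  P.mem_part _ h _ (Sym2.mem_mk_right u v)

variable {P}

theorem adj (hK : K ∈ P.cliques) {u v : V} (hu : u ∈ K) (hv : v ∈ K) (huv : u ≠ v) : G.Adj u v :=
  P.isClique K hK hu hv huv

theorem dist_le_one (hK : K ∈ P.cliques) {u v : V} (hu : u ∈ K) (hv : v ∈ K) :
    G.dist u v ≤ 1 := by
  by_cases huv : u = v
  · simp [huv]
  · exact (dist_eq_one_iff_adj.2 (adj hK hu hv huv)).le

theorem eq_of_mem (hK : K ∈ P.cliques) (hL : L ∈ P.cliques) {u v : V} (huv : u ≠ v)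
    (hu : u ∈ K) (hv : v ∈ K) (hu' : u ∈ L) (hv' : v ∈ L) : K = L := by
  rw [← P.part_eq K hK u hu v hv huv, P.part_eq L hL u hu' v hv' huv]

theorem not_geodesicPair (hK : K ∈ P.cliques) {e f : Sym2 V} (he : ∀ v ∈ e, v ∈ K)
    (hf : ∀ v ∈ f, v ∈ K) : ¬ G.GeodesicPair e f := by
  rintro ⟨a, b, c, d, rfl, rfl, h⟩
  have := dist_le_one hK (he a (by simp)) (hf d (by simp))
  omega

/-- Two cliques of the partition that share the vertex `z`: an edge of the first that avoids `z`
does not lie on a common geodesic with an edge of the second. -/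
theorem not_geodesicPair_of_notMem (hG : G.Connected) (hK : K ∈ P.cliques) (hL : L ∈ P.cliques)
    (hKL : L ≠ K) {z : V} (hzK : z ∈ K) (hzL : z ∈ L) {e f : Sym2 V} (he : ∀ v ∈ e, v ∈ K)
    (hze : z ∉ e) (hf : ∀ v ∈ f, v ∈ L) : ¬ G.GeodesicPair e f := by
  rintro ⟨a, b, c, d, rfl, rfl, h⟩
  have h1 := dist_le_one hK (he a (by simp)) hzK
  have h2 := dist_le_one hL hzL (hf d (by simp))
  have h3 := hG.dist_triangle (u := a) (v := z) (w := d)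
  have hbz : b ≠ z := fun hb => hze (by simp [hb])
  -- As `z` gives d(a, d) ≤ 2, the pair would need `b = c`, a second common vertex of the two
  -- cliques.
  have hbc : b ≠ c := by
    rintro rfl
    exact hKL (eq_of_mem hL hK hbz (hf b (by simp)) hzL (he b (by simp)) hzK)
  have := hG.pos_dist_of_ne hbc
  omega

variable (P)

theorem src_le [Fintype V] (hG : G.Connected) : G.src ≤ P.cliques.card := by
  refine hG.src_le_card_of_not_geodesicPair P.cliques P.part P.part_mem fun e he f hf hef => ?_
  exact not_geodesicPair (P.part_mem e he) (P.mem_part e he) (by rw [hef]; exact P.mem_part f hf)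

/-! ### Recolorings that save the color of a clique -/

variable {P}

theorem src_lt_of_coloring [Fintype V] (hK : K ∈ P.cliques) (κ : Sym2 V → Finset V)
    (hκ : ∀ e ∈ G.edgeSet, κ e ∈ P.cliques ∧ κ e ≠ K)
    (h : ∀ u v : V, ∃ p : G.Walk u v, p.length = G.dist u v ∧
      ∀ e ∈ p.edges, ∀ f ∈ p.edges, κ e = κ f → e = f) : G.src < P.cliques.card := by
  classical
  refine (src_le_card (P.cliques.erase K) κ (fun e he => ?_) h).trans_lt
    (Finset.card_erase_lt_of_mem hK)
  exact Finset.mem_erase.2 ⟨(hκ e he).2, (hκ e he).1⟩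

theorem src_lt_of_not_geodesicPair [Fintype V] (hG : G.Connected) (hK : K ∈ P.cliques)
    (κ : Sym2 V → Finset V) (hκ : ∀ e ∈ G.edgeSet, κ e ∈ P.cliques ∧ κ e ≠ K)
    (h : ∀ e ∈ G.edgeSet, ∀ f ∈ G.edgeSet, κ e = κ f → ¬ G.GeodesicPair e f) :
    G.src < P.cliques.card := by
  classical
  refine (hG.src_le_card_of_not_geodesicPair (P.cliques.erase K) κ (fun e he => ?_) h).trans_lt
    (Finset.card_erase_lt_of_mem hK)
  exact Finset.mem_erase.2 ⟨(hκ e he).2, (hκ e he).1⟩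

/-- A recoloring of the edges of `K` alone: it suffices that every edge of `K` gets the color of
a clique with whose edges it does not share a geodesic. -/
theorem src_lt_of_recolor [Fintype V] (hG : G.Connected) (hK : K ∈ P.cliques)
    (g : Sym2 V → Finset V)
    (hg : ∀ e ∈ G.edgeSet, (∀ v ∈ e, v ∈ K) → g e ∈ P.cliques ∧ g e ≠ K ∧
      ∀ f ∈ G.edgeSet, (∀ v ∈ f, v ∈ g e) → ¬ G.GeodesicPair e f) :
    G.src < P.cliques.card := by
  classical
  have hpart : ∀ e ∈ G.edgeSet, P.part e = K → ∀ v ∈ e, v ∈ K := fun e he h v hv =>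
    h ▸ P.mem_part e he v hv
  refine src_lt_of_not_geodesicPair hG hK (fun e => if P.part e = K then g e else P.part e)
    (fun e he => ?_) fun e he f hf hef => ?_
  · split_ifs with h
    · exact ⟨(hg e he (hpart e he h)).1, (hg e he (hpart e he h)).2.1⟩
    · exact ⟨P.part_mem e he, h⟩
  · split_ifs at hef with h1 h2 h2
    · exact not_geodesicPair hK (hpart e he h1) (hpart f hf h2)
    · exact (hg e he (hpart e he h1)).2.2 f hf (by rw [hef]; exact P.mem_part f hf)
    · intro h
      exact (hg f hf (hpart f hf h2)).2.2 e he (by rw [← hef]; exact P.mem_part e he) h.symm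
    · exact not_geodesicPair (P.part_mem e he) (P.mem_part e he)
        (by rw [hef]; exact P.mem_part f hf)

/-- Every edge of `K` avoids one of `x`, `y`, `z` and can take the color of the clique attached at
the avoided vertex. -/
theorem src_lt_of_three_cliques [Fintype V] (hG : G.Connected) (hK : K ∈ P.cliques) {x y z : V}
    (hx : x ∈ K) (hy : y ∈ K) (hz : z ∈ K) (hxy : x ≠ y) (hyz : y ≠ z) (hxz : x ≠ z)
    {X Y Z : Finset V} (hX : X ∈ P.cliques) (hY : Y ∈ P.cliques) (hZ : Z ∈ P.cliques)
    (hXK : X ≠ K) (hYK : Y ≠ K) (hZK : Z ≠ K) (hxX : x ∈ X) (hyY : y ∈ Y) (hzZ : z ∈ Z) :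
    G.src < P.cliques.card := by
  classical
  refine src_lt_of_recolor hG hK (fun e => if z ∈ e then if x ∈ e then Y else X else Z)
    fun e he heK => ?_
  split_ifs with h1 h2
  · refine ⟨hY, hYK, fun f _ => not_geodesicPair_of_notMem hG hK hY hYK hy hyY heK fun h3 => ?_⟩
    rw [(Sym2.mem_and_mem_iff hxz).1 ⟨h2, h1⟩, Sym2.mem_iff] at h3
    exact h3.elim (fun h => hxy h.symm) hyz
  · exact ⟨hX, hXK, fun f _ => not_geodesicPair_of_notMem hG hK hX hXK hx hxX heK h2⟩
  · exact ⟨hZ, hZK, fun f _ => not_geodesicPair_of_notMem hG hK hZ hZK hz hzZ heK h1⟩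

/-- Three vertices of a clique of the partition that all have a neighbor outside of it. -/
theorem src_lt_of_adj_notMem [Fintype V] (hG : G.Connected) (hK : K ∈ P.cliques) {x y z : V}
    (hx : x ∈ K) (hy : y ∈ K) (hz : z ∈ K) (hxy : x ≠ y) (hyz : y ≠ z) (hxz : x ≠ z)
    {x' y' z' : V} (hxx' : G.Adj x x') (hyy' : G.Adj y y') (hzz' : G.Adj z z') (hx' : x' ∉ K)
    (hy' : y' ∉ K) (hz' : z' ∉ K) : G.src < P.cliques.card :=
  src_lt_of_three_cliques hG hK hx hy hz hxy hyz hxz (P.part_mem _ hxx') (P.part_mem _ hyy')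
    (P.part_mem _ hzz') (fun h => hx' (h ▸ P.mem_part_right hxx'))
    (fun h => hy' (h ▸ P.mem_part_right hyy')) (fun h => hz' (h ▸ P.mem_part_right hzz'))
    (P.mem_part_left hxx') (P.mem_part_left hyy') (P.mem_part_left hzz')

/-- If all neighbors of `x` are among `b`, `w`, then geodesics can be chosen such that none of them
contains both edges `aw` and `wx`, provided that `abw` is a triangle. -/
theorem exists_geodesic_not_mem_edges (hG : G.Connected) {a b w x : V} (hab : G.Adj a b)
    (hax : a ≠ x) (hbw : G.Adj b w) (hxb : G.Adj x b)
    (hxw : G.Adj x w) (hx : ∀ n, G.Adj x n → n = b ∨ n = w) (u v : V) :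
    ∃ p : G.Walk u v, p.length = G.dist u v ∧ ¬ (s(a, w) ∈ p.edges ∧ s(w, x) ∈ p.edges) := by
  have key : ∀ u, ∃ p : G.Walk u x, p.length = G.dist u x ∧
      ¬ (s(a, w) ∈ p.edges ∧ s(w, x) ∈ p.edges) := by
    intro u
    by_cases hux : u = x
    · subst hux
      exact ⟨.nil, by simp, by simp⟩
    have hb := hG.dist_le_dist_add_one (u := u) hxb
    have hw := hG.dist_le_dist_add_one (u := u) hxw
    by_cases h : G.dist u b + 1 = G.dist u x
    · obtain ⟨q, hq⟩ := hG.exists_walk_length_eq_dist u b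
      refine ⟨q.concat hxb.symm, by simp [hq, h], fun ⟨_, h2⟩ => ?_⟩
      simp only [Walk.edges_concat, List.concat_eq_append, List.mem_append,
        List.mem_singleton] at h2
      rcases h2 with h2 | h2
      · obtain ⟨c, e, h3, h4⟩ := q.exists_dist_of_mem_edges hG hq h2
        rcases Sym2.eq_iff.1 h3 with ⟨rfl, rfl⟩ | ⟨rfl, rfl⟩ <;> omega
      · rcases Sym2.eq_iff.1 h2 with ⟨rfl, _⟩ | ⟨rfl, _⟩
        · exact hbw.ne rfl
        · exact hxw.ne rfl
    -- Here `b` is not closer to `u` than `x`. A geodesic using `aw` on its way to `x` would have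
    -- `a` two steps closer, and then the neighbor `b` of `a` would be closer as well.
    · obtain ⟨p, hp⟩ := hG.exists_walk_length_eq_dist u x
      refine ⟨p, hp, fun ⟨h1, _⟩ => ?_⟩
      obtain ⟨n, hn, hnu⟩ := hG.exists_adj_dist_add_one (Ne.symm hux)
      rw [G.dist_comm (u := n), G.dist_comm (u := x)] at hnu
      have hab' := hG.dist_le_dist_add_one (u := u) hab.symm
      have h5 := dist_eq_one_iff_adj.2 hxw.symm
      have h6 := hG.pos_dist_of_ne hax
      obtain ⟨c, e, h3, h4⟩ := p.exists_dist_of_mem_edges hG hp h1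
      rcases hx n hn with rfl | rfl
      · exact h hnu
      · rcases Sym2.eq_iff.1 h3 with ⟨rfl, rfl⟩ | ⟨rfl, rfl⟩ <;> omega
  by_cases hv : v = x
  · exact hv ▸ key u
  by_cases hu : u = x
  · subst hu
    obtain ⟨p, hp, h⟩ := key v
    exact ⟨p.reverse, by simp [hp, G.dist_comm (u := v)], by simpa using h⟩
  -- Now `x` is no end of the geodesic, nor an inner vertex since its neighbors `b` and `w` are
  -- adjacent; so `wx` is not used.
  obtain ⟨p, hp⟩ := hG.exists_walk_length_eq_dist u v
  refine ⟨p, hp, fun ⟨_, h⟩ => ?_⟩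
  have hbu := hG.dist_triangle (u := u) (v := b) (w := v)
  have hwu := hG.dist_triangle (u := u) (v := w) (w := v)
  have hbw2 := hG.dist_le_dist_add_one (u := u) hbw
  have hbw3 := hG.dist_le_dist_add_one' (u := v) hbw
  obtain ⟨c, e, h3, h4⟩ := p.exists_dist_of_mem_edges hG hp h
  obtain ⟨n, hn, hnv⟩ := hG.exists_adj_dist_add_one (Ne.symm hv)
  obtain ⟨n', hn', hnu⟩ := hG.exists_adj_dist_add_one (Ne.symm hu)
  rw [G.dist_comm (u := n'), G.dist_comm (u := x)] at hnu
  rcases Sym2.eq_iff.1 h3 with ⟨rfl, rfl⟩ | ⟨rfl, rfl⟩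
  · rcases hx n hn with rfl | rfl <;> omega
  · rcases hx n' hn' with rfl | rfl <;> omega

theorem src_lt_of_triangle [Fintype V] (hG : G.Connected)
    (hcard : ∀ K ∈ P.cliques, K.card ≤ 3) {a b w : V} (hab : G.Adj a b) (haw : G.Adj a w)
    (hbw : G.Adj b w) (hw : w ∉ P.part s(a, b)) : G.src < P.cliques.card := by
  classical
  obtain ⟨K, hKdef⟩ : ∃ K, K = P.part s(a, b) := ⟨_, rfl⟩
  obtain ⟨A, hAdef⟩ : ∃ A, A = P.part s(a, w) := ⟨_, rfl⟩
  obtain ⟨B, hBdef⟩ : ∃ B, B = P.part s(b, w) := ⟨_, rfl⟩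
  have hK : K ∈ P.cliques := hKdef ▸ P.part_mem _ hab
  have hA : A ∈ P.cliques := hAdef ▸ P.part_mem _ haw
  have hB : B ∈ P.cliques := hBdef ▸ P.part_mem _ hbw
  have haK : a ∈ K := hKdef ▸ P.mem_part_left hab
  have hbK : b ∈ K := hKdef ▸ P.mem_part_right hab
  have haA : a ∈ A := hAdef ▸ P.mem_part_left haw
  have hwA : w ∈ A := hAdef ▸ P.mem_part_right haw
  have hbB : b ∈ B := hBdef ▸ P.mem_part_left hbw
  have hwB : w ∈ B := hBdef ▸ P.mem_part_right hbw
  rw [← hKdef] at hw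
  have hAK : A ≠ K := fun h => hw (h ▸ hwA)
  have hBK : B ≠ K := fun h => hw (h ▸ hwB)
  have haB : a ∉ B := fun h => hBK (eq_of_mem hB hK hab.ne h hbB haK hbK)
  have hAB : A ≠ B := fun h => haB (h ▸ haA)
  have dab := dist_eq_one_iff_adj.2 hab
  have daw := dist_eq_one_iff_adj.2 haw
  have dbw := dist_eq_one_iff_adj.2 hbw
  -- If `B` is the single edge `bw`, the color of `K` is saved: `ab` can take the color of `B`,
  -- because edges of a triangle do not share a geodesic.
  by_cases hB2 : ∀ v ∈ B, v = b ∨ v = w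
  · refine src_lt_of_recolor hG hK (fun e => if b ∈ e then if a ∈ e then B else A else B)
      fun e he heK => ?_
    split_ifs with h1 h2
    · refine ⟨hB, hBK, fun f hf hfB => ?_⟩
      rw [(Sym2.mem_and_mem_iff hab.ne).1 ⟨h2, h1⟩]
      induction f with | _ p q =>
      rw [geodesicPair_mk_iff]
      have hpq : p ≠ q := G.ne_of_adj hf
      have dbb := G.dist_self (v := b)
      rcases hB2 p (hfB p (by simp)) with rfl | rfl <;>
        rcases hB2 q (hfB q (by simp)) with rfl | rfl <;> first | exact absurd rfl hpq | omega
    · exact ⟨hA, hAK, fun f _ => not_geodesicPair_of_notMem hG hK hA hAK haK haA heK h2⟩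
    · exact ⟨hB, hBK, fun f _ => not_geodesicPair_of_notMem hG hK hB hBK hbK hbB heK h1⟩
  push Not at hB2
  obtain ⟨x, hxB, hxb, hxw⟩ := hB2
  have hB3 : ∀ v ∈ B, v = b ∨ v = w ∨ v = x := by
    have h3 : ({b, w, x} : Finset V) ⊆ B := by
      simp [Finset.insert_subset_iff, hbB, hwB, hxB]
    have h4 : ({b, w, x} : Finset V).card = 3 := by
      rw [Finset.card_eq_three]
      exact ⟨b, w, x, hbw.ne, hxb.symm, hxw.symm, rfl⟩
    have h5 := Finset.eq_of_subset_of_card_le h3 (by rw [h4]; exact hcard B hB)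
    intro v hv
    rw [← h5] at hv
    simpa using hv
  by_cases hxout : ∃ x', G.Adj x x' ∧ x' ∉ B
  · obtain ⟨x', hxx', hx'⟩ := hxout
    exact src_lt_of_three_cliques hG hB hbB hwB hxB hbw.ne hxw.symm hxb.symm hK hA
      (P.part_mem _ hxx') hBK.symm hAB (fun h => hx' (h ▸ P.mem_part_right hxx')) hbK hwA
      (P.mem_part_left hxx')
  push Not at hxout
  have hx : ∀ n, G.Adj x n → n = b ∨ n = w := fun n hn => by
    rcases hB3 n (hxout n hn) with h | h | rfl
    · exact .inl h
    · exact .inr h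
    · exact absurd rfl hn.ne
  -- From here on `B` is a triangle `bwx` with no edge leaving it at `x`. Its color is saved by
  -- giving its edges the color of `A`, and the edges of `A` off `a` that of `K`. The only possible
  -- conflict is between `wx` and `aw`, and geodesics can be chosen to avoid it.
  have core : ∀ e ∈ G.edgeSet, ∀ f ∈ G.edgeSet, P.part e = B → P.part f = A → a ∈ f →
      G.GeodesicPair e f → e = s(w, x) ∧ f = s(a, w) := by
    intro e he f hf heB hfA haf hef
    obtain ⟨q, rfl⟩ := haf
    induction e with | _ p p' =>
    have hpp' : p ≠ p' := G.ne_of_adj he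
    have hp : p ∈ B := heB ▸ P.mem_part_left he
    have hp' : p' ∈ B := heB ▸ P.mem_part_right he
    have hq : q ∈ A := hfA ▸ P.mem_part_right hf
    have hwq := dist_le_one hA hwA hq
    have d1 : ∀ p ∈ B, 1 ≤ G.dist p a ∧ G.dist p a ≤ 2 ∧ G.dist p q ≤ 2 := fun p hp => by
      have h1 := hG.pos_dist_of_ne (fun h : p = a => haB (h ▸ hp))
      have h2 := dist_le_one hB hp hwB
      have h3 := hG.dist_triangle (u := p) (v := w) (w := a)
      have h4 := hG.dist_triangle (u := p) (v := w) (w := q)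
      rw [G.dist_comm (u := w) (v := a)] at h3
      omega
    obtain ⟨h1, h2, h3⟩ := d1 p hp
    obtain ⟨h4, h5, h6⟩ := d1 p' hp'
    rw [geodesicPair_mk_iff] at hef
    by_cases hqw : q = w
    · subst hqw
      have dx : G.dist x q ≤ 1 := dist_le_one hB hxB hwB
      have dba := G.dist_comm (u := b) (v := a)
      have dwa := G.dist_comm (u := q) (v := a)
      have dqq := G.dist_self (v := q)
      refine ⟨?_, rfl⟩
      rcases hB3 p hp with rfl | rfl | rfl <;> rcases hB3 p' hp' with rfl | rfl | rfl <;>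
        first | exact absurd rfl hpp' | rfl | exact Sym2.eq_swap | (exfalso; omega)
    · have hqB : ∀ p ∈ B, 1 ≤ G.dist p q := fun p hp => hG.pos_dist_of_ne fun h =>
        hAB (eq_of_mem hA hB hqw hq hwA (h ▸ hp) hwB)
      have := hqB p hp
      have := hqB p' hp'
      omega
  have hmem : ∀ e ∈ G.edgeSet, ∀ {C}, P.part e = C → ∀ v ∈ e, v ∈ C := fun e he C h =>
    h ▸ P.mem_part e he
  refine src_lt_of_coloring hB
    (fun e => if P.part e = B then A else if P.part e = A ∧ a ∉ e then K else P.part e)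
    (fun e he => ?_) fun u v => ?_
  · split_ifs with h1 h2
    · exact ⟨hA, hAB⟩
    · exact ⟨hK, hBK.symm⟩
    · exact ⟨P.part_mem e he, h1⟩
  obtain ⟨p, hp, hpe⟩ := exists_geodesic_not_mem_edges hG hab (fun h => haB (h ▸ hxB)) hbw
    (adj hB hxB hbB hxb) (adj hB hxB hwB hxw) hx u v
  refine ⟨p, hp, fun e he f hf hef => ?_⟩
  by_contra hne
  have hg := p.geodesicPair_of_mem_edges hG hp he hf hne
  have he' := p.edges_subset_edgeSet he
  have hf' := p.edges_subset_edgeSet hf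
  split_ifs at hef with h1 h2 h3 h3 h4 h5 h4 h5
  · exact not_geodesicPair hB (hmem e he' h1) (hmem f hf' h2) hg
  · exact hAK hef
  · have haf : a ∈ f := by
      by_contra h
      exact h3 ⟨hef.symm, h⟩
    obtain ⟨rfl, rfl⟩ := core e he' f hf' h1 hef.symm haf hg
    exact hpe ⟨hf, he⟩
  · exact hAK hef.symm
  · exact not_geodesicPair hA (hmem e he' h3.1) (hmem f hf' h5.1) hg
  · exact not_geodesicPair_of_notMem hG hA hK hAK.symm haA haK (hmem e he' h3.1) h3.2
      (hmem f hf' hef.symm) hg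
  · have hae : a ∈ e := by
      by_contra h
      exact h3 ⟨hef, h⟩
    obtain ⟨rfl, rfl⟩ := core f hf' e he' h4 hef hae hg.symm
    exact hpe ⟨he, hf⟩
  · exact not_geodesicPair_of_notMem hG hA hK hAK.symm haA haK (hmem f hf' h5.1) h5.2
      (hmem e he' hef) hg.symm
  · exact not_geodesicPair (P.part_mem e he') (P.mem_part e he') (hmem f hf' hef.symm) hg

/-! ### Shortest cycles of length at least four -/

/-- Two opposite edges `ab` and `cd` of an even (`d(a, d) = r - 1`) or odd (`d(a, d) = r`) cycle
without shortcuts save a color. -/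
theorem src_lt_of_opposite_edges [Fintype V] (hG : G.Connected) {a b c d a' b' d' : V} {r : ℕ}
    (hr : 2 ≤ r) (hab : G.Adj a b) (hcd : G.Adj c d) (hac : G.dist a c = r)
    (hbd : G.dist b d = r) (hbc : G.dist b c + 1 = r)
    (had : G.dist a d + 1 = r ∨ G.dist a d = r)
    (haa' : G.Adj a a') (hbb' : G.Adj b b') (hdd' : G.Adj d d')
    (ha'b : a' ≠ b) (hb'a : b' ≠ a) (hd'c : d' ≠ c)
    (hna : ¬ G.Adj a' b) (hnb : ¬ G.Adj b' a) (hnd : ¬ G.Adj d' c) :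
    G.src < P.cliques.card := by
  classical
  obtain ⟨K, hKdef⟩ : ∃ K, K = P.part s(a, b) := ⟨_, rfl⟩
  obtain ⟨L, hLdef⟩ : ∃ L, L = P.part s(c, d) := ⟨_, rfl⟩
  obtain ⟨A, hAdef⟩ : ∃ A, A = P.part s(a, a') := ⟨_, rfl⟩
  obtain ⟨B, hBdef⟩ : ∃ B, B = P.part s(b, b') := ⟨_, rfl⟩
  obtain ⟨D, hDdef⟩ : ∃ D, D = P.part s(d, d') := ⟨_, rfl⟩
  have hK : K ∈ P.cliques := hKdef ▸ P.part_mem _ hab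
  have hL : L ∈ P.cliques := hLdef ▸ P.part_mem _ hcd
  have hA : A ∈ P.cliques := hAdef ▸ P.part_mem _ haa'
  have hB : B ∈ P.cliques := hBdef ▸ P.part_mem _ hbb'
  have hD : D ∈ P.cliques := hDdef ▸ P.part_mem _ hdd'
  have haK : a ∈ K := hKdef ▸ P.mem_part_left hab
  have hbK : b ∈ K := hKdef ▸ P.mem_part_right hab
  have hcL : c ∈ L := hLdef ▸ P.mem_part_left hcd
  have hdL : d ∈ L := hLdef ▸ P.mem_part_right hcd
  have haA : a ∈ A := hAdef ▸ P.mem_part_left haa'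
  have ha'A : a' ∈ A := hAdef ▸ P.mem_part_right haa'
  have hbB : b ∈ B := hBdef ▸ P.mem_part_left hbb'
  have hb'B : b' ∈ B := hBdef ▸ P.mem_part_right hbb'
  have hdD : d ∈ D := hDdef ▸ P.mem_part_left hdd'
  have hd'D : d' ∈ D := hDdef ▸ P.mem_part_right hdd'
  have hLK : L ≠ K := fun h => by
    have := dist_le_one hK haK (h ▸ hcL)
    omega
  have hAK : A ≠ K := fun h => hna (adj hK (h ▸ ha'A) hbK ha'b)
  have hBK : B ≠ K := fun h => hnb (adj hK (h ▸ hb'B) haK hb'a)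
  have hDL : D ≠ L := fun h => hnd (adj hL (h ▸ hd'D) hcL hd'c)
  have hDB : D ≠ B := fun h => by
    have := dist_le_one hB hbB (h ▸ hdD)
    omega
  have hDA : G.dist a d = r → D ≠ A := fun h h' => by
    have := dist_le_one hA haA (h' ▸ hdD)
    omega
  have hDK : D ≠ K := fun h => by
    have := dist_le_one hK hbK (h ▸ hdD)
    omega
  have hmem : ∀ e ∈ G.edgeSet, ∀ {C}, P.part e = C → ∀ v ∈ e, v ∈ C := fun e he C h =>
    h ▸ P.mem_part e he
  have core : ∀ f ∈ G.edgeSet, P.part f = L → (G.dist a d = r → d ∈ f) →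
      ¬ G.GeodesicPair s(a, b) f := by
    intro f hf hfL hd
    have h0 : ∀ p ∈ L, G.dist a p ≤ r + 1 ∧ r ≤ G.dist a p + 1 ∧ G.dist b p ≤ r ∧
        r ≤ G.dist b p + 1 ∧ (G.dist a d + 1 = r → G.dist a p ≤ r) := fun p hp => by
      have h1 := dist_le_one hL hcL hp
      have h2 := dist_le_one hL hdL hp
      have h3 := hG.dist_triangle (u := a) (v := c) (w := p)
      have h4 := hG.dist_triangle (u := b) (v := c) (w := p)
      have h5 := hG.dist_triangle (u := a) (v := p) (w := c)
      have h6 := hG.dist_triangle (u := b) (v := p) (w := d)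
      have h7 := hG.dist_triangle (u := a) (v := d) (w := p)
      rw [G.dist_comm (u := p)] at h5 h6
      omega
    rcases had with had | had
    · induction f with | _ p q =>
      have hp := h0 p (hmem _ hf hfL p (by simp))
      have hq := h0 q (hmem _ hf hfL q (by simp))
      rw [geodesicPair_mk_iff]
      omega
    · obtain ⟨q, rfl⟩ := hd had
      have hq := h0 q (hmem _ hf hfL q (by simp))
      rw [geodesicPair_mk_iff]
      omega
  -- The edge `ab` takes the color of `L`. In the odd case an edge `cp` of `L` may continue a
  -- geodesic from `a` through `b` and `c`; such edges avoid `d` and move to the color of `D`.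
  obtain ⟨S, hS⟩ : ∃ S : Sym2 V → Prop, ∀ e, S e ↔ P.part e = L ∧ G.dist a d = r ∧ d ∉ e :=
    ⟨_, fun _ => Iff.rfl⟩
  have hSK : ∀ e, S e → P.part e ≠ K := fun e h h' => hLK (((hS e).1 h).1.symm.trans h')
  obtain ⟨g, hg⟩ : ∃ g : Sym2 V → Finset V,
      ∀ e, g e = if a ∈ e then if b ∈ e then L else B else A := ⟨_, fun _ => rfl⟩
  have hgmem : ∀ e, g e ∈ P.cliques ∧ g e ≠ K ∧ (G.dist a d = r → g e ≠ D) := fun e => by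
    rw [hg]
    split_ifs
    · exact ⟨hL, hLK, fun _ => hDL.symm⟩
    · exact ⟨hB, hBK, fun _ => hDB.symm⟩
    · exact ⟨hA, hAK, fun h => (hDA h).symm⟩
  have hgpair : ∀ e ∈ G.edgeSet, ∀ f ∈ G.edgeSet, P.part e = K → P.part f = g e → ¬ S f →
      ¬ G.GeodesicPair e f := by
    intro e he f hf heK hfe hSf
    rw [hg] at hfe
    split_ifs at hfe with h1 h2
    · rw [(Sym2.mem_and_mem_iff hab.ne).1 ⟨h1, h2⟩]
      exact core f hf hfe fun h => by_contra fun h' => hSf ((hS f).2 ⟨hfe, h, h'⟩)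
    · exact not_geodesicPair_of_notMem hG hK hB hBK hbK hbB (hmem e he heK) h2 (hmem f hf hfe)
    · exact not_geodesicPair_of_notMem hG hK hA hAK haK haA (hmem e he heK) h1 (hmem f hf hfe)
  have hSpair : ∀ e ∈ G.edgeSet, ∀ f ∈ G.edgeSet, S e → P.part f = D → ¬ G.GeodesicPair e f :=
    fun e he f hf hSe hfD => not_geodesicPair_of_notMem hG hL hD hDL hdL hdD
      (hmem e he ((hS e).1 hSe).1) ((hS e).1 hSe).2.2 (hmem f hf hfD)
  refine src_lt_of_not_geodesicPair hG hK
    (fun e => if P.part e = K then g e else if S e then D else P.part e)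
    (fun e he => ?_) fun e he f hf hef => ?_
  · split_ifs with h1 h2
    · exact ⟨(hgmem e).1, (hgmem e).2.1⟩
    · exact ⟨hD, hDK⟩
    · exact ⟨P.part_mem e he, h1⟩
  split_ifs at hef with h1 h2 h3 h3 h4 h5 h4 h5
  · exact not_geodesicPair hK (hmem e he h1) (hmem f hf h2)
  · exact absurd hef ((hgmem e).2.2 ((hS f).1 h3).2.1)
  · exact hgpair e he f hf h1 hef.symm h3
  · exact absurd hef.symm ((hgmem f).2.2 ((hS e).1 h3).2.1)
  · exact not_geodesicPair hL (hmem e he ((hS e).1 h3).1) (hmem f hf ((hS f).1 h5).1)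
  · exact hSpair e he f hf h3 hef.symm
  · exact fun h => hgpair f hf e he h4 hef h3 h.symm
  · exact fun h => hSpair f hf e he h5 hef h.symm
  · exact not_geodesicPair (P.part_mem e he) (P.mem_part e he) (hmem f hf hef.symm)

/-- If no color can be saved, then there is no shortest even or odd cycle without shortcuts: every
vertex has at most one neighbor that is closer to `u`, and adjacent vertices at the same distance
`r` from `u` have a common neighbor that is closer to `u`. -/
theorem not_opposite_config [Fintype V] (hG : G.Connected) (hP : ¬ G.src < P.cliques.card)
    (hD : ∀ a b w w', G.Adj a b → G.Adj a w → G.Adj b w → G.Adj a w' → G.Adj b w' → w = w')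
    (r : ℕ) :
    (∀ u v w d, G.dist u v = r → G.Adj v w → G.Adj v d → G.dist u w + 1 = r →
      G.dist u d + 1 = r → w = d) ∧
    (∀ u c d, G.Adj c d → G.dist u c = r → G.dist u d = r →
      ∃ q, G.Adj q c ∧ G.Adj q d ∧ G.dist u q + 1 = r) := by
  induction r using Nat.strong_induction_on with | _ r ih =>
  have heven : ∀ u v w d, G.dist u v = r → G.Adj v w → G.Adj v d → G.dist u w + 1 = r →
      G.dist u d + 1 = r → w = d := by
    intro a c w d hac hcw hcd haw had
    by_contra hwd
    have hr1 := ih (r - 1) (by omega)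
    -- If `wd` were an edge, a common neighbor `q` one level closer and `c` would both complete it
    -- to a triangle, against `hD`.
    have hwd' : ¬ G.Adj w d := fun h => by
      obtain ⟨q, hqw, hqd, hq⟩ := hr1.2 a w d h (by omega) (by omega)
      have := hD w d c q h hcw.symm hcd.symm hqw.symm hqd.symm
      subst this
      omega
    have hr : 2 ≤ r := by
      by_contra hr
      have h1 : G.dist a w = 0 := by omega
      have h2 : G.dist a d = 0 := by omega
      rw [hG.dist_eq_zero_iff] at h1 h2
      exact hwd (h1.symm.trans h2)
    obtain ⟨b, hab, hbw⟩ := hG.exists_adj_dist_add_one (u := a) (v := w) (fun h => by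
      have := hG.dist_eq_zero_iff.2 h
      omega)
    have hbc : G.dist b c + 1 = r := by
      have h1 := hG.dist_le_dist_add_one (u := b) hcw
      have h2 := hG.dist_le_dist_add_one' (u := c) hab
      omega
    have hbd : G.dist b d = r := by
      have h1 := hG.dist_le_dist_add_one' (u := d) hab
      have h2 := hG.dist_le_dist_add_one' (u := d) hab.symm
      by_contra h3
      rcases (by omega : G.dist b d + 2 = r ∨ G.dist b d + 1 = r) with h4 | h4
      · exact hwd (hr1.1 b c w d (by omega) hcw hcd (by omega) (by omega))
      · obtain ⟨q, hqc, hqd, hq⟩ := hr1.2 b c d hcd (by omega) (by omega)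
        have := hr1.1 b c q w (by omega) hqc.symm hcw (by omega) (by omega)
        exact hwd' (this ▸ hqd)
    obtain ⟨a', haa', ha'd⟩ := hG.exists_adj_dist_add_one (u := a) (v := d) (fun h => by
      have := hG.dist_eq_zero_iff.2 h
      omega)
    obtain ⟨b', hbb', hb'c⟩ := hG.exists_adj_dist_add_one (u := b) (v := c) (fun h => by
      have := hG.dist_eq_zero_iff.2 h
      omega)
    obtain ⟨d', hdd', hd'a⟩ := hG.exists_adj_dist_add_one (u := d) (v := a) (fun h => by
      have := hG.dist_eq_zero_iff.2 h
      rw [dist_comm] at this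
      omega)
    rw [G.dist_comm (u := d), G.dist_comm (u := d')] at hd'a
    refine hP (src_lt_of_opposite_edges hG hr hab hcd hac hbd hbc (.inl had) haa' hbb' hdd'
      ?_ ?_ ?_ ?_ ?_ ?_)
    · rintro rfl
      omega
    · rintro rfl
      omega
    · rintro rfl
      omega
    · intro h
      have := hG.dist_le_dist_add_one' (u := d) h.symm
      omega
    · intro h
      have := hG.dist_le_dist_add_one' (u := c) h.symm
      omega
    · intro h
      have := hG.dist_le_dist_add_one (u := a) h.symm
      omega
  refine ⟨heven, fun a c d hcd hac had => ?_⟩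
  by_contra! hq
  have hr0 : 1 ≤ r := by
    by_contra hr
    have h1 : G.dist a c = 0 := by omega
    have h2 : G.dist a d = 0 := by omega
    rw [hG.dist_eq_zero_iff] at h1 h2
    exact hcd.ne (h1.symm.trans h2)
  have hr1 := ih (r - 1) (by omega)
  have hr : 2 ≤ r := by
    by_contra hr
    exact hq a (dist_eq_one_iff_adj.1 (by omega)) (dist_eq_one_iff_adj.1 (by omega))
      (by rw [dist_self]; omega)
  obtain ⟨b, hab, hbc⟩ := hG.exists_adj_dist_add_one (u := a) (v := c) (fun h => by
    have := hG.dist_eq_zero_iff.2 h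
    omega)
  have hbd : G.dist b d = r := by
    have h1 := hG.dist_le_dist_add_one' (u := d) hab
    have h2 := hG.dist_le_dist_add_one (u := b) hcd.symm
    by_contra h3
    obtain ⟨q, hqc, hqd, hbq⟩ := hr1.2 b c d hcd (by omega) (by omega)
    have h4 := hG.dist_le_dist_add_one' (u := q) hab
    have h5 := hG.dist_le_dist_add_one (u := a) hqc.symm
    exact hq q hqc hqd (by omega)
  obtain ⟨a', haa', ha'd⟩ := hG.exists_adj_dist_add_one (u := a) (v := d) (fun h => by
    have := hG.dist_eq_zero_iff.2 h
    omega)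
  obtain ⟨b', hbb', hb'c⟩ := hG.exists_adj_dist_add_one (u := b) (v := c) (fun h => by
    have := hG.dist_eq_zero_iff.2 h
    omega)
  obtain ⟨d', hdd', hd'a⟩ := hG.exists_adj_dist_add_one (u := d) (v := a) (fun h => by
    have := hG.dist_eq_zero_iff.2 h
    rw [dist_comm] at this
    omega)
  rw [G.dist_comm (u := d), G.dist_comm (u := d')] at hd'a
  refine hP (src_lt_of_opposite_edges hG hr hab hcd hac hbd (by omega) (.inr had) haa' hbb' hdd'
    ?_ ?_ ?_ ?_ ?_ ?_)
  · rintro rfl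
    omega
  · rintro rfl
    omega
  · rintro rfl
    omega
  -- If `a'b` were an edge, a geodesic from `d` to `a'` would start with a neighbor closer to `b`.
  -- By the even case this is `c`, which puts `c` too close to `a`.
  · intro h
    obtain ⟨w, hdw, hwa'⟩ := hG.exists_adj_dist_add_one (u := d) (v := a') (fun h => by
      have := hG.dist_eq_zero_iff.2 h
      rw [dist_comm] at this
      omega)
    rw [G.dist_comm (u := d), G.dist_comm (u := w)] at hwa'
    have h1 := hG.dist_le_dist_add_one' (u := w) h.symm
    have h2 := hG.dist_le_dist_add_one (u := b) hdw
    have := heven b d w c hbd hdw hcd.symm (by omega) (by omega)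
    subst this
    have := hG.dist_le_dist_add_one' (u := w) haa'
    omega
  · intro h
    have := hG.dist_le_dist_add_one' (u := c) h.symm
    omega
  · exact fun h => hq d' h hdd'.symm (by omega)

end EdgeCliquePartition

/-! ### Blocks, cliques and cycles -/

namespace Subgraph

theorem le_deleteVerts_singleton {H K : G.Subgraph} (h : H ≤ K) {x : V} (hx : x ∉ H.verts) :
    H ≤ K.deleteVerts {x} := by
  have hne : ∀ {v}, v ∈ H.verts → v ∉ ({x} : Set V) := fun {v} hv hvx =>
    hx (Set.mem_singleton_iff.1 hvx ▸ hv)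
  refine ⟨fun v hv => ⟨h.1 hv, hne hv⟩, fun u v huv => ?_⟩
  rw [deleteVerts_adj]
  exact ⟨h.1 huv.fst_mem, hne huv.fst_mem, h.1 huv.snd_mem, hne huv.snd_mem, h.2 huv⟩

theorem connected_induce_of_isClique {s : Set V} (hs : G.IsClique s) (hne : s.Nonempty) :
    ((⊤ : G.Subgraph).induce s).Connected := by
  rw [connected_iff_forall_exists_walk_subgraph]
  refine ⟨hne, fun {u v} hu hv => ?_⟩
  by_cases huv : u = v
  · subst huv
    exact ⟨.nil, by simpa using hu⟩
  · refine ⟨(hs hu hv huv).toWalk, ?_⟩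
    refine ⟨fun w hw => ?_, fun a b hab => ?_⟩
    · simp at hw
      rcases hw with rfl | rfl <;> assumption
    · simp at hab
      rcases hab with ⟨rfl, rfl⟩ | ⟨rfl, rfl⟩
      · exact ⟨hu, hv, hs hu hv huv⟩
      · exact ⟨hv, hu, hs hv hu (Ne.symm huv)⟩

theorem not_isCutVertex_induce_of_isClique {s : Set V} (hs : G.IsClique s) (x : V) :
    ¬ ((⊤ : G.Subgraph).induce s).IsCutVertex x := by
  rintro ⟨_, h⟩
  refine h ?_
  rw [show ((⊤ : G.Subgraph).induce s).deleteVerts {x} = (⊤ : G.Subgraph).induce (s \ {x}) by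
    ext u v
    · simp
    · simp; tauto]
  rcases (s \ {x}).eq_empty_or_nonempty with h0 | h0
  · rw [preconnected_iff_forall_exists_walk_subgraph]
    intro u v hu
    rw [h0] at hu
    exact hu.elim
  · exact (connected_induce_of_isClique (hs.subset Set.sdiff_subset) h0).preconnected

theorem exists_isBlock_ge [Finite V] {H : G.Subgraph} (hc : H.Connected)
    (hH : ∀ v, ¬ H.IsCutVertex v) : ∃ B : G.Subgraph, H ≤ B ∧ B.IsBlock :=
  Finite.exists_le_maximal (p := fun H : G.Subgraph => H.Connected ∧ ∀ v, ¬ H.IsCutVertex v)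
    ⟨hc, hH⟩

end Subgraph

/-- Rotated to start at `x`, the cycle without `x` is a path, and each of its vertices is reached
from the second vertex of the cycle. -/
theorem Walk.IsCycle.not_isCutVertex {u : V} {c : G.Walk u u} (hc : c.IsCycle) (x : V) :
    ¬ c.toSubgraph.IsCutVertex x := by
  classical
  rintro ⟨hx, h⟩
  refine h ?_
  rw [Walk.mem_verts_toSubgraph] at hx
  have hc' := hc.rotate hx
  rw [← Walk.toSubgraph_rotate c hx] at h ⊢
  generalize c.rotate x hx = c' at hc'
  cases c' with
  | nil => exact (hc'.not_nil .nil).elim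
  | @cons _ y _ hxy q =>
    rw [Walk.cons_isCycle_iff] at hc'
    rw [Subgraph.preconnected_iff_forall_exists_walk_subgraph]
    have key : ∀ a, a ∈ ((Walk.cons hxy q).toSubgraph.deleteVerts {x}).verts →
        ∃ p : G.Walk y a, p.toSubgraph ≤ (Walk.cons hxy q).toSubgraph.deleteVerts {x} := by
      intro a ha
      rw [Subgraph.deleteVerts_verts] at ha
      have hax : a ≠ x := fun h => ha.2 (by simp [h])
      have haq : a ∈ q.support := by
        have := ha.1
        rw [Walk.mem_verts_toSubgraph, Walk.support_cons, List.mem_cons] at this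
        exact this.resolve_left hax
      refine ⟨q.takeUntil a haq, Subgraph.le_deleteVerts_singleton ?_ ?_⟩
      · rw [Walk.toSubgraph]
        refine le_trans ?_ le_sup_right
        conv_rhs => rw [← q.take_spec haq, Walk.toSubgraph_append]
        exact le_sup_left
      · rw [Walk.mem_verts_toSubgraph]
        exact Walk.endpoint_notMem_support_takeUntil hc'.1 haq hax.symm
    intro a b ha hb
    obtain ⟨p, hp⟩ := key a ha
    obtain ⟨p', hp'⟩ := key b hb
    refine ⟨p.reverse.append p', ?_⟩
    rw [Walk.toSubgraph_append, Walk.toSubgraph_reverse]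
    exact sup_le hp hp'

/-- If every block is a bridge or a triangle, then the vertices of a cycle form a triangle. -/
theorem Walk.IsCycle.exists_isNClique_of_blocks [Finite V]
    (hB : ∀ B : G.Subgraph, B.IsBlock → B.IsBridgeSubgraph ∨ B.IsTriangleSubgraph)
    {u : V} {c : G.Walk u u} (hc : c.IsCycle) :
    ∃ s : Finset V, G.IsNClique 3 s ∧ ∀ v ∈ s, v ∈ c.support := by
  classical
  have hcard : 3 ≤ c.support.toFinset.card := by
    have h1 := hc.support_nodup
    have h2 := List.toFinset_card_of_nodup h1
    have h3 := hc.three_le_length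
    have h4 : c.support.tail.toFinset ⊆ c.support.toFinset := fun v hv => by
      rw [List.mem_toFinset] at hv ⊢
      exact List.mem_of_mem_tail hv
    have h5 := Finset.card_le_card h4
    simp only [List.length_tail, Walk.length_support, Nat.add_sub_cancel] at h2
    omega
  obtain ⟨B, hle, hblock⟩ := Subgraph.exists_isBlock_ge c.toSubgraph_connected hc.not_isCutVertex
  have hsub : ∀ v ∈ c.support, v ∈ B.verts := fun v hv =>
    hle.1 (c.mem_verts_toSubgraph.2 hv)
  rcases hB B hblock with ⟨x, y, hxy, _, rfl⟩ | ⟨s, hs, rfl⟩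
  · have : c.support.toFinset ⊆ {x, y} := fun v hv => by
      have := hsub v (List.mem_toFinset.1 hv)
      simpa using this
    have := (Finset.card_le_card this).trans Finset.card_le_two
    omega
  · have h1 : c.support.toFinset ⊆ s := fun v hv => by
      have := hsub v (List.mem_toFinset.1 hv)
      simpa using this
    have h2 := Finset.eq_of_subset_of_card_le h1 (by rw [hs.card_eq]; exact hcard)
    exact ⟨s, hs, fun v hv => List.mem_toFinset.1 (h2 ▸ hv)⟩

/-- If there is no shortest cycle of length at least four, then all blocks are bridges or
triangles. -/
theorem Connected.isBlock_bridge_or_triangle [Finite V] [Nontrivial V] (hG : G.Connected)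
    (hD : ∀ a b w w', G.Adj a b → G.Adj a w → G.Adj b w → G.Adj a w' → G.Adj b w' → w = w')
    (heven : ∀ u v w d, G.Adj v w → G.Adj v d → G.dist u w + 1 = G.dist u v →
      G.dist u d + 1 = G.dist u v → w = d)
    (hodd : ∀ u c d, G.Adj c d → G.dist u c = G.dist u d →
      ∃ q, G.Adj q c ∧ G.Adj q d ∧ G.dist u q + 1 = G.dist u c)
    (B : G.Subgraph) (hB : B.IsBlock) : B.IsBridgeSubgraph ∨ B.IsTriangleSubgraph := by
  classical
  obtain ⟨u, hu⟩ := hB.1.1.nonempty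
  -- The block is explored from a vertex `v` farthest from `u`, so that no step inside it leads to a
  -- higher level.
  obtain ⟨v, hv, hmax⟩ := Set.exists_max_image B.verts (G.dist u) (Set.toFinite _) ⟨u, hu⟩
  have hle_clique : ∀ s : Finset V, G.IsClique s → (∀ x ∈ B.verts, x ∈ s) →
      B = (⊤ : G.Subgraph).induce s := by
    intro s hs hBs
    have hne : (s : Set V).Nonempty := ⟨u, hBs u hu⟩
    refine hB.eq_of_le ⟨Subgraph.connected_induce_of_isClique hs hne,
      Subgraph.not_isCutVertex_induce_of_isClique hs⟩
      ⟨hBs, fun a b hab => ⟨hBs a hab.fst_mem, hBs b hab.snd_mem, hab.adj_sub⟩⟩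
  have huv : v ≠ u := by
    rintro rfl
    obtain ⟨n, hn⟩ := hG.preconnected.exists_adj_of_nontrivial v
    have h1 : ∀ x ∈ B.verts, x = v := fun x hx => by
      have := hmax x hx
      rw [dist_self, Nat.le_zero, hG.dist_eq_zero_iff] at this
      exact this.symm
    have h2 := hle_clique {v, n} (by simpa [IsClique] using fun _ => hn) (fun x hx => by
      simp [h1 x hx])
    have h3 : n ∈ B.verts := by simp [h2]
    exact hn.ne (h1 n h3).symm
  obtain ⟨p, hvp, hp⟩ := hG.exists_adj_dist_add_one huv
  rw [G.dist_comm (u := p), G.dist_comm (u := v)] at hp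
  have hlevel : ∀ x, G.Adj x v → G.Adj x p → G.dist u x = G.dist u v := fun x hxv hxp => by
    have h1 := hG.dist_le_dist_add_one (u := u) hxp
    have h2 := hG.dist_le_dist_add_one (u := u) hxv.symm
    by_contra h3
    have := heven u v p x hvp hxv.symm hp (by omega)
    exact hxp.ne this.symm
  -- the vertices of the block other than `p` are `v` and the common neighbors of `v` and `p`
  have hBverts : ∀ x ∈ B.verts, x = p ∨ x = v ∨ (G.Adj x v ∧ G.Adj x p) := by
    have hpre : (B.deleteVerts {p}).Preconnected := by
      by_cases hpB : p ∈ B.verts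
      · by_contra h
        exact hB.1.2 p ⟨hpB, h⟩
      · rw [show B.deleteVerts {p} = B from
          le_antisymm Subgraph.deleteVerts_le (Subgraph.le_deleteVerts_singleton le_rfl hpB)]
        exact hB.1.1.preconnected
    -- A step from `x` that avoids `p` cannot go down by `heven`, nor up by the choice of `v`. By
    -- `hodd` and `heven` a level step stays adjacent to `p`, and `hD` leaves only `v` and its
    -- neighbors.
    have hstep : ∀ x y, (x = v ∨ (G.Adj x v ∧ G.Adj x p)) → (B.deleteVerts {p}).Adj x y →
        y = v ∨ (G.Adj y v ∧ G.Adj y p) := by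
      intro x y hx hxy
      rw [Subgraph.deleteVerts_adj] at hxy
      obtain ⟨_, _, hyB, hyp, hxy⟩ := hxy
      have hxy := hxy.adj_sub
      have hxp : G.Adj x p ∧ G.dist u x = G.dist u v := by
        rcases hx with rfl | hx
        · exact ⟨hvp, rfl⟩
        · exact ⟨hx.2, hlevel x hx.1 hx.2⟩
      have h1 := hmax y hyB
      have h2 := hG.dist_le_dist_add_one (u := u) hxy
      have hyv : G.dist u x = G.dist u y := by
        by_contra h3
        exact hyp (heven u x y p hxy hxp.1 (by omega) (by omega))
      obtain ⟨q, hqx, hqy, hq⟩ := hodd u x y hxy hyv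
      have := heven u x q p hqx.symm hxp.1 hq (by omega)
      subst this
      rcases hx with rfl | hx
      · exact .inr ⟨hxy.symm, hqy.symm⟩
      · exact .inl (hD x q y v hxp.1 hxy hqy hx.1 hvp.symm)
    have hwalk : ∀ x y (w : G.Walk x y), w.toSubgraph ≤ B.deleteVerts {p} →
        (x = v ∨ (G.Adj x v ∧ G.Adj x p)) → (y = v ∨ (G.Adj y v ∧ G.Adj y p)) := by
      intro x y w hw hx
      induction w with
      | nil => exact hx
      | cons h q ih =>
        rw [Walk.toSubgraph, sup_le_iff] at hw
        exact ih hw.2 (hstep _ _ hx (hw.1.2 (by simp)))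
    intro x hx
    by_cases hxp : x = p
    · exact .inl hxp
    rw [Subgraph.preconnected_iff_forall_exists_walk_subgraph] at hpre
    obtain ⟨w, hw⟩ := hpre (u := v) (v := x) ⟨hv, hvp.ne⟩ ⟨hx, hxp⟩
    exact .inr (hwalk v x w hw (.inl rfl))
  by_cases hsib : ∃ v', G.Adj v' v ∧ G.Adj v' p
  · obtain ⟨v', hv'v, hv'p⟩ := hsib
    have hs : G.IsNClique 3 {p, v, v'} := by
      rw [is3Clique_triple_iff]
      exact ⟨hvp.symm, hv'p.symm, hv'v.symm⟩
    refine .inr ⟨_, hs, hle_clique _ hs.isClique fun x hx => ?_⟩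
    rcases hBverts x hx with rfl | rfl | h
    · simp
    · simp
    · simp [hD v p x v' hvp h.1.symm h.2.symm hv'v.symm hv'p.symm]
  · push Not at hsib
    have hcl : G.IsClique (({p, v} : Finset V) : Set V) := by
      simpa [IsClique] using fun _ => hvp.symm
    have hBeq : B = G.subgraphOfAdj hvp.symm := by
      rw [Subgraph.subgraphOfAdj_eq_induce, hle_clique _ hcl fun x hx => ?_]
      · simp
      · rcases hBverts x hx with rfl | rfl | h
        · simp
        · simp
        · exact (hsib x h.1 h.2).elim
    refine .inl ⟨p, v, hvp.symm, ?_, hBeq⟩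
    rw [isBridge_iff_forall_cycle_notMem hvp.symm]
    intro x c hc hmem
    -- A cycle through `pv` would contain the block and equal it by maximality, but it has at least
    -- three vertices.
    have hle : B ≤ c.toSubgraph := by
      rw [hBeq]
      exact subgraphOfAdj_le_of_adj _ (by rwa [Walk.adj_toSubgraph_iff_mem_edges])
    have heq := hB.eq_of_le ⟨c.toSubgraph_connected, hc.not_isCutVertex⟩ hle
    have h1 := hc.three_le_length
    have h2 := List.toFinset_card_of_nodup hc.support_nodup
    have h3 : c.support.tail.toFinset ⊆ {p, v} := fun y hy => by
      rw [List.mem_toFinset] at hy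
      have := c.mem_verts_toSubgraph.2 (List.mem_of_mem_tail hy)
      rw [← heq, hBeq] at this
      simpa using this
    have h4 := (Finset.card_le_card h3).trans Finset.card_le_two
    simp only [List.length_tail, Walk.length_support, Nat.add_sub_cancel] at h2
    omega

/-! ### The partition obtained from edge-disjoint triangles -/

theorem EdgeCliquePartition.sum_choose_two [Fintype V] [DecidableEq V] [DecidableRel G.Adj]
    (P : G.EdgeCliquePartition) :
    ∑ K ∈ P.cliques, K.card.choose 2 = G.edgeFinset.card := by
  rw [Finset.card_eq_sum_card_fiberwise (f := P.part) (t := P.cliques)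
    fun e he => P.part_mem e (mem_edgeFinset.1 he)]
  refine Finset.sum_congr rfl fun K hK => ?_
  rw [← Sym2.card_image_offDiag]
  congr 1
  ext e
  induction e with | _ u v =>
  simp only [Finset.mem_image, Finset.mem_offDiag, Finset.mem_filter, mem_edgeFinset, mem_edgeSet]
  constructor
  · rintro ⟨⟨a, b⟩, ⟨ha, hb, hab⟩, h⟩
    rw [← mem_edgeSet, ← h]
    exact ⟨EdgeCliquePartition.adj hK ha hb hab, P.part_eq K hK a ha b hb hab⟩
  · rintro ⟨huv, h⟩
    exact ⟨(u, v), ⟨h ▸ P.mem_part_left huv, h ▸ P.mem_part_right huv, huv.ne⟩, rfl⟩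

/-- Edge-disjoint triangles together with the remaining edges partition the edges of `G`. -/
theorem exists_edgeCliquePartition [Fintype V] [DecidableEq V] [DecidableRel G.Adj]
    {T : Finset (Finset V)} (hT : ∀ s ∈ T, G.IsNClique 3 s)
    (hdisj : (T : Set (Finset V)).PairwiseDisjoint G.edgesWithin) :
    ∃ P : G.EdgeCliquePartition, P.cliques.card + 2 * T.card = G.edgeFinset.card ∧
      (∀ K ∈ P.cliques, K.card ≤ 3) ∧ (∀ K ∈ P.cliques, K.card = 3 → K ∈ T) ∧
      T ⊆ P.cliques := by
  classical
  have hpart : ∀ e : Sym2 V, ∃ K : Finset V, (∀ v ∈ e, v ∈ K) ∧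
      (K ∈ T ∨ (∀ s ∈ T, ¬ ∀ v ∈ e, v ∈ s) ∧ K = e.toFinset) := by
    intro e
    by_cases h : ∃ s ∈ T, ∀ v ∈ e, v ∈ s
    · obtain ⟨s, hs, he⟩ := h
      exact ⟨s, he, .inl hs⟩
    · push Not at h
      exact ⟨e.toFinset, by simp, .inr ⟨by simpa using h, rfl⟩⟩
  choose part hmem hpart using hpart
  let R := (G.edgeFinset.filter fun e => ∀ s ∈ T, ¬ ∀ v ∈ e, v ∈ s).image Sym2.toFinset
  have hR : ∀ K ∈ R, ∃ e ∈ G.edgeSet, (∀ s ∈ T, ¬ ∀ v ∈ e, v ∈ s) ∧ K = e.toFinset := by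
    intro K hK
    obtain ⟨e, he, rfl⟩ := Finset.mem_image.1 hK
    rw [Finset.mem_filter, mem_edgeFinset] at he
    exact ⟨e, he.1, he.2, rfl⟩
  have hRcard : ∀ K ∈ R, K.card = 2 := by
    intro K hK
    obtain ⟨e, he, _, rfl⟩ := hR K hK
    exact Sym2.card_toFinset_of_not_isDiag e (G.not_isDiag_of_mem_edgeSet he)
  let P : G.EdgeCliquePartition :=
    { cliques := T ∪ R
      part := part
      isClique := fun K hK => by
        rcases Finset.mem_union.1 hK with hK | hK
        · exact (hT K hK).isClique
        · obtain ⟨e, he, _, rfl⟩ := hR K hK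
          intro u hu v hv huv
          rw [Finset.mem_coe, Sym2.mem_toFinset] at hu hv
          rwa [(Sym2.mem_and_mem_iff huv).1 ⟨hu, hv⟩] at he
      part_mem := fun e he => by
        rw [Finset.mem_union]
        rcases hpart e with h | h
        · exact .inl h
        · refine .inr (Finset.mem_image.2 ⟨e, ?_, h.2.symm⟩)
          rw [Finset.mem_filter, mem_edgeFinset]
          exact ⟨he, h.1⟩
      mem_part := fun e _ => hmem e
      part_eq := fun K hK u hu v hv huv => by
        rcases Finset.mem_union.1 hK with hK | hK
        · have hKe : ∀ w ∈ s(u, v), w ∈ K := fun w hw => by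
            rcases Sym2.mem_iff.1 hw with rfl | rfl <;> assumption
          rcases hpart s(u, v) with h | h
          · by_contra hne
            have hadj : s(u, v) ∈ G.edgeSet := (hT K hK).isClique hu hv huv
            exact Set.disjoint_left.1 (hdisj h hK hne) ⟨hadj, hmem _⟩ ⟨hadj, hKe⟩
          · exact absurd hKe (h.1 K hK)
        · obtain ⟨e, he, hes, rfl⟩ := hR K hK
          rw [Sym2.mem_toFinset] at hu hv
          have heq := (Sym2.mem_and_mem_iff huv).1 ⟨hu, hv⟩
          subst heq
          rcases hpart s(u, v) with h | h
          · exact absurd (hmem _) (hes _ h)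
          · exact h.2 }
  have hPc : P.cliques = T ∪ R := rfl
  have hdisjTR : Disjoint T R := Finset.disjoint_left.2 fun K hK hK' => by
    have h1 := (hT K hK).card_eq
    have h2 := hRcard K hK'
    omega
  refine ⟨P, ?_, ?_, ?_, Finset.subset_union_left⟩
  · have h1 := P.sum_choose_two
    have h2 : ∑ K ∈ T, K.card.choose 2 = ∑ K ∈ T, 3 :=
      Finset.sum_congr rfl fun K hK => by rw [(hT K hK).card_eq]; rfl
    have h3 : ∑ K ∈ R, K.card.choose 2 = ∑ K ∈ R, 1 :=
      Finset.sum_congr rfl fun K hK => by rw [hRcard K hK]; rfl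
    rw [hPc, Finset.sum_union hdisjTR, h2, h3] at h1
    simp only [Finset.sum_const, smul_eq_mul] at h1
    rw [hPc, Finset.card_union_of_disjoint hdisjTR, ← h1]
    ring
  · intro K hK
    rcases Finset.mem_union.1 hK with hK | hK
    · exact (hT K hK).card_eq.le
    · rw [hRcard K hK]
      norm_num
  · intro K hK h3
    rcases Finset.mem_union.1 hK with hK | hK
    · exact hK
    · have := hRcard K hK
      omega

/-! ### Equality forces the structure -/

theorem Connected.inTriangleTreeClass_of_src_eq [Fintype V] [DecidableEq V] [Nontrivial V]
    [DecidableRel G.Adj] (hG : G.Connected) {T : Finset (Finset V)}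
    (hT : ∀ s ∈ T, G.IsNClique 3 s) (P : G.EdgeCliquePartition)
    (hsrc : ¬ G.src < P.cliques.card) (hcard : ∀ K ∈ P.cliques, K.card ≤ 3)
    (hcard3 : ∀ K ∈ P.cliques, K.card = 3 → K ∈ T) (hTP : T ⊆ P.cliques) :
    G.InTriangleTreeClass T.card := by
  have htri : ∀ a b w, G.Adj a b → G.Adj a w → G.Adj b w → w ∈ P.part s(a, b) := by
    intro a b w hab haw hbw
    by_contra hw
    exact hsrc (EdgeCliquePartition.src_lt_of_triangle hG hcard hab haw hbw hw)
  have hsub : ∀ a b w, G.Adj a b → G.Adj a w → G.Adj b w → {a, b, w} = P.part s(a, b) := by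
    intro a b w hab haw hbw
    refine Finset.eq_of_subset_of_card_le ?_ ?_
    · simp only [Finset.insert_subset_iff, Finset.singleton_subset_iff]
      exact ⟨P.mem_part_left hab, P.mem_part_right hab, htri a b w hab haw hbw⟩
    · rw [Finset.card_eq_three.2 ⟨a, b, w, hab.ne, haw.ne, hbw.ne, rfl⟩]
      exact hcard _ (P.part_mem _ hab)
  have hD : ∀ a b w w', G.Adj a b → G.Adj a w → G.Adj b w → G.Adj a w' → G.Adj b w' →
      w = w' := by
    intro a b w w' hab haw hbw haw' hbw'
    have h : w' ∈ ({a, b, w} : Finset V) := by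
      rw [hsub a b w hab haw hbw]
      exact htri a b w' hab haw' hbw'
    simp only [Finset.mem_insert, Finset.mem_singleton] at h
    rcases h with rfl | rfl | rfl
    · exact absurd rfl haw'.ne
    · exact absurd rfl hbw'.ne
    · rfl
  have hcl : G.cliqueFinset 3 = T := by
    ext s
    rw [mem_cliqueFinset_iff]
    refine ⟨fun hs => ?_, hT s⟩
    obtain ⟨a, b, w, hab, haw, hbw, rfl⟩ := is3Clique_iff.1 hs
    have := hsub a b w hab haw hbw
    refine hcard3 _ (this ▸ P.part_mem _ hab) hs.card_eq
  have hconf := EdgeCliquePartition.not_opposite_config hG hsrc hD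
  refine ⟨hG, hG.isBlock_bridge_or_triangle hD (fun u v w d hvw hvd hw hd => ?_)
    (fun u c d hcd h => ?_), by rw [hcl], fun s hs => ?_⟩
  · exact (hconf _).1 u v w d rfl hvw hvd hw hd
  · exact (hconf _).2 u c d hcd rfl h.symm
  · rw [hcl] at hs
    have hsP := hTP hs
    by_contra! hdeg
    have key : ∀ v ∈ s, ∃ v', G.Adj v v' ∧ v' ∉ s := by
      intro v hv
      by_contra! h
      refine hdeg v hv ?_
      have : G.neighborFinset v = s.erase v := by
        ext w
        rw [mem_neighborFinset, Finset.mem_erase]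
        exact ⟨fun hw => ⟨hw.ne', h w hw⟩, fun hw => (hT s hs).isClique hv hw.2 hw.1.symm⟩
      rw [← card_neighborFinset_eq_degree, this, Finset.card_erase_of_mem hv, (hT s hs).card_eq]
    obtain ⟨x, y, z, hxy, hxz, hyz, hxyz⟩ := Finset.card_eq_three.1 (hT s hs).card_eq
    have hx : x ∈ s := by simp [hxyz]
    have hy : y ∈ s := by simp [hxyz]
    have hz : z ∈ s := by simp [hxyz]
    obtain ⟨x', hx1, hx2⟩ := key x hx
    obtain ⟨y', hy1, hy2⟩ := key y hy
    obtain ⟨z', hz1, hz2⟩ := key z hz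
    exact hsrc (EdgeCliquePartition.src_lt_of_adj_notMem hG hsP hx hy hz hxy hyz hxz hx1 hy1 hz1
      hx2 hy2 hz2)

/-! ### The lower bound for graphs of the class -/

theorem IsAcyclic.mem_edges_of_length_le (hG : G.IsAcyclic) {a b d : V} (hab : G.Adj a b)
    {p : G.Walk a d} (hp : p.IsPath) {q : G.Walk b d} (hq : q.IsPath) (h : q.length ≤ p.length) :
    s(a, b) ∈ p.edges := by
  classical
  by_cases hb : b ∈ p.support
  · have h1 := (hG.subsingleton_path _ _).elim ⟨p.takeUntil b hb, hp.takeUntil hb⟩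
      ⟨hab.toWalk, by simp [Walk.cons_isPath_iff, hab.ne]⟩
    have h2 : p.takeUntil b hb = hab.toWalk := congrArg Subtype.val h1
    refine p.edges_takeUntil_subset_edges hb ?_
    simp [h2]
  -- If `b` is off `p`, the unique path from `b` to `d` runs through `a` and is longer than `p`.
  · have h1 := (hG.subsingleton_path _ _).elim ⟨q, hq⟩
      ⟨Walk.cons hab.symm p, (Walk.cons_isPath_iff _ _).2 ⟨hp, hb⟩⟩
    have h2 : q = Walk.cons hab.symm p := congrArg Subtype.val h1
    rw [h2, Walk.length_cons] at h
    omega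

/-- A vertex whose neighbors form a clique is not an inner vertex of a geodesic. -/
theorem Walk.notMem_support_of_isClique_neighborSet (hG : G.Connected) {u v x : V}
    (p : G.Walk u v) (hp : p.length = G.dist u v) (hx : G.IsClique (G.neighborSet x))
    (hu : u ≠ x) (hv : v ≠ x) : x ∉ p.support := by
  intro h
  rw [Walk.mem_support_iff_exists_getVert] at h
  obtain ⟨i, hi, hil⟩ := h
  have h0 : i ≠ 0 := by
    rintro rfl
    exact hu (by simpa using hi)
  have h1 : i ≠ p.length := by
    rintro rfl
    exact hv (by simpa using hi)
  obtain ⟨j, rfl⟩ := Nat.exists_eq_succ_of_ne_zero h0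
  have h2 := p.adj_getVert_succ (i := j) (by omega)
  have h3 := p.adj_getVert_succ (i := j + 1) (by omega)
  have h4 := p.dist_getVert_of_length_eq_dist hG hp (i := j) (j := j + 1 + 1) (by omega)
    (by omega)
  rw [Nat.succ_eq_add_one] at hi
  rw [hi] at h2 h3
  by_cases h5 : p.getVert j = p.getVert (j + 1 + 1)
  · rw [h5, dist_self] at h4
    omega
  · have := dist_eq_one_iff_adj.2 (hx h2.symm h3 h5)
    omega

/-- Two edges that remain after the deletion of the vertices of `R` get different colors in every
strong rainbow coloring, if a forest remains and the vertices of `R` are simplicial. -/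
theorem IsStrongRainbowColoring.ne_of_isAcyclic_deleteEdges [DecidableEq V] (hG : G.Connected)
    {K : Type*} {c : G.edgeSet → K} (hc : G.IsStrongRainbowColoring c) {R : Set V}
    (hR : ∀ x ∈ R, G.IsClique (G.neighborSet x))
    (hF : (G.deleteEdges {e | ∃ x ∈ R, x ∈ e}).IsAcyclic) {e f : G.edgeSet}
    (he : ∀ x ∈ R, x ∉ e.1) (hf : ∀ x ∈ R, x ∉ f.1) (hef : c e = c f) : e = f := by
  -- With the farthest ends `a` and `d`, the other end of either edge is no farther away, so in the
  -- forest both edges lie on the path from `a` to `d`.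
  obtain ⟨⟨a, d⟩, had, hmax⟩ := Finset.exists_max_image (e.1.toFinset ×ˢ f.1.toFinset)
    (fun x => G.dist x.1 x.2) (Finset.Nonempty.product
      ⟨_, Sym2.mem_toFinset.2 (Sym2.out_fst_mem e.1)⟩
      ⟨_, Sym2.mem_toFinset.2 (Sym2.out_fst_mem f.1)⟩)
  rw [Finset.mem_product, Sym2.mem_toFinset, Sym2.mem_toFinset] at had
  obtain ⟨b, hb⟩ := had.1
  obtain ⟨b', hb'⟩ := had.2
  dsimp only at hb hb' hmax
  have hge : ∀ x ∈ e.1, ∀ y ∈ f.1, G.dist x y ≤ G.dist a d := fun x hx y hy =>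
    hmax (x, y) (Finset.mem_product.2 ⟨Sym2.mem_toFinset.2 hx, Sym2.mem_toFinset.2 hy⟩)
  have hadj : ∀ {x y}, G.Adj x y → (∀ z ∈ R, z ∉ s(x, y)) →
      (G.deleteEdges {e | ∃ x ∈ R, x ∈ e}).Adj x y := fun {x y} hxy h => by
    rw [deleteEdges_adj]
    exact ⟨hxy, fun ⟨z, hz, hz'⟩ => h z hz hz'⟩
  -- geodesics between vertices outside of `R` are paths of the forest
  have hgeo : ∀ x y, x ∉ R → y ∉ R → ∀ p : G.Walk x y, p.length = G.dist x y →
      ∃ q : (G.deleteEdges {e | ∃ x ∈ R, x ∈ e}).Walk x y, q.IsPath ∧ q.length = G.dist x y ∧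
        q.edges = p.edges := by
    intro x y hx hy p hp
    have hedge : ∀ g ∈ p.edges, g ∈ (G.deleteEdges {e | ∃ x ∈ R, x ∈ e}).edgeSet := by
      intro g hg
      rw [edgeSet_deleteEdges]
      refine ⟨p.edges_subset_edgeSet hg, fun ⟨z, hz, hzg⟩ => ?_⟩
      refine p.notMem_support_of_isClique_neighborSet hG hp (hR z hz) (fun h => hx (h ▸ hz))
        (fun h => hy (h ▸ hz)) ?_
      obtain ⟨z', rfl⟩ := hzg
      exact p.fst_mem_support_of_mem_edges hg
    exact ⟨p.transfer _ hedge, (p.isPath_of_length_eq_dist hp).transfer hedge, by simp [hp],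
      by simp⟩
  have haR : a ∉ R := fun h => he a h had.1
  have hdR : d ∉ R := fun h => hf d h had.2
  have hbR : b ∉ R := fun h => he b h (by simp [hb])
  have hb'R : b' ∉ R := fun h => hf b' h (by simp [hb'])
  obtain ⟨p, hp, hlen⟩ := hc a d
  obtain ⟨q, hq, hql, hqe⟩ := hgeo a d haR hdR p hlen
  obtain ⟨p1, hp1⟩ := hG.exists_walk_length_eq_dist b d
  obtain ⟨q1, hq1, hq1l, -⟩ := hgeo b d hbR hdR p1 hp1
  obtain ⟨p2, hp2⟩ := hG.exists_walk_length_eq_dist b' a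
  obtain ⟨q2, hq2, hq2l, -⟩ := hgeo b' a hb'R haR p2 hp2
  have hab : G.Adj a b := by
    rw [← mem_edgeSet, ← hb]
    exact e.2
  have hdb' : G.Adj d b' := by
    rw [← mem_edgeSet, ← hb']
    exact f.2
  have h1 : s(a, b) ∈ q.edges := hF.mem_edges_of_length_le (hadj hab (hb ▸ he)) hq hq1 (by
    rw [hql, hq1l]
    exact hge b (by simp [hb]) d had.2)
  have h2 : s(d, b') ∈ q.reverse.edges :=
    hF.mem_edges_of_length_le (hadj hdb' (hb' ▸ hf)) hq.reverse hq2 (by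
      rw [Walk.length_reverse, hql, hq2l, dist_comm]
      exact hge a had.1 b' (by simp [hb']))
  rw [Walk.edges_reverse, List.mem_reverse, hqe] at h2
  rw [hqe] at h1
  exact hp.2 e f (hb ▸ h1) (hb' ▸ h2) hef

theorem InTriangleTreeClass.card_edgeFinset_le [Fintype V] [DecidableEq V] [DecidableRel G.Adj]
    {t : ℕ} (h : G.InTriangleTreeClass t) : G.edgeFinset.card ≤ G.src + 2 * t := by
  have hG := h.connected
  have hy : ∀ s : Finset V, ∃ v, s ∈ G.cliqueFinset 3 → v ∈ s ∧ G.degree v = 2 := fun s => by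
    by_cases hs : s ∈ G.cliqueFinset 3
    · obtain ⟨v, hv⟩ := h.degree_two s hs
      exact ⟨v, fun _ => hv⟩
    · exact ⟨hG.nonempty.some, fun h => absurd h hs⟩
  choose y hy using hy
  let R := (G.cliqueFinset 3).image y
  have hR : ∀ x ∈ (R : Set V), G.IsClique (G.neighborSet x) := by
    intro x hx
    obtain ⟨s, hs, rfl⟩ := Finset.mem_image.1 hx
    have hcl := mem_cliqueFinset_iff.1 hs
    have hsub : s.erase (y s) ⊆ G.neighborFinset (y s) := fun v hv => by
      rw [Finset.mem_erase] at hv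
      rw [mem_neighborFinset]
      exact hcl.isClique (hy s hs).1 hv.2 hv.1.symm
    have heq := Finset.eq_of_subset_of_card_le hsub (by
      rw [card_neighborFinset_eq_degree, (hy s hs).2, Finset.card_erase_of_mem (hy s hs).1,
        hcl.card_eq])
    refine hcl.isClique.subset fun v hv => ?_
    rw [mem_neighborSet, ← mem_neighborFinset, ← heq] at hv
    exact Finset.mem_of_mem_erase hv
  -- A cycle of `G` passes through all vertices of some triangle, hence through its chosen vertex,
  -- whose edges are deleted.
  have hF : (G.deleteEdges {e | ∃ x ∈ (R : Set V), x ∈ e}).IsAcyclic := by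
    intro u c hc
    obtain ⟨s, hs, hsc⟩ := (hc.mapLe (G.deleteEdges_le _)).exists_isNClique_of_blocks h.blocks
    have hs' := mem_cliqueFinset_iff.2 hs
    have hmem := hsc _ (hy s hs').1
    rw [Walk.support_mapLe_eq_support,
      Walk.mem_support_iff_exists_mem_edges_of_not_nil hc.not_nil] at hmem
    obtain ⟨e, he, hye⟩ := hmem
    have := c.edges_subset_edgeSet he
    rw [edgeSet_deleteEdges] at this
    exact this.2 ⟨y s, Finset.mem_coe.2 (Finset.mem_image_of_mem y hs'), hye⟩
  obtain ⟨c, hc⟩ : ∃ c : G.edgeSet → Fin G.src, G.IsStrongRainbowColoring c :=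
    Nat.sInf_mem (exists_isStrongRainbowColoring hG)
  let S := G.edgeFinset.filter fun e => ∀ x ∈ R, x ∉ e
  have hSmem : ∀ e ∈ S, e ∈ G.edgeSet ∧ ∀ x ∈ (R : Set V), x ∉ e := fun e he => by
    rw [Finset.mem_filter, mem_edgeFinset] at he
    exact he
  have hS : S.card ≤ G.src := by
    rw [← Finset.card_attach, ← Fintype.card_fin G.src]
    refine Finset.card_le_card_of_injOn (fun e => c ⟨e.1, (hSmem _ e.2).1⟩) (by simp) ?_
    intro e _ f _ hef
    have := hc.ne_of_isAcyclic_deleteEdges hG hR hF (hSmem _ e.2).2 (hSmem _ f.2).2 hef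
    exact Subtype.ext (Subtype.mk.inj this)
  have hcover : G.edgeFinset ⊆ S ∪ R.biUnion fun x => G.incidenceFinset x := by
    intro e he
    rw [Finset.mem_union, Finset.mem_biUnion]
    by_cases h : ∀ x ∈ R, x ∉ e
    · exact .inl (Finset.mem_filter.2 ⟨he, h⟩)
    · push Not at h
      obtain ⟨x, hx, hxe⟩ := h
      exact .inr ⟨x, hx, (G.mem_incidenceFinset x e).2 ⟨mem_edgeFinset.1 he, hxe⟩⟩
  have hRcard : R.card ≤ t := h.card_triangles ▸ Finset.card_image_le
  have hinc : (R.biUnion fun x => G.incidenceFinset x).card ≤ R.card * 2 := by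
    refine Finset.card_biUnion_le_card_mul _ _ _ fun x hx => ?_
    obtain ⟨s, hs, rfl⟩ := Finset.mem_image.1 hx
    rw [card_incidenceFinset_eq_degree, (hy s hs).2]
  have h1 := Finset.card_le_card hcover
  have h2 := Finset.card_union_le S (R.biUnion fun x => G.incidenceFinset x)
  omega

end SimpleGraph

theorem theorem2 {V : Type*} [Fintype V] [DecidableEq V] [Nontrivial V]
    (G : SimpleGraph V) [DecidableRel G.Adj] (hG : G.Connected)
    (m t : ℕ) (hm : G.edgeFinset.card = m) (ht : G.HasEdgeDisjointTriangles t) :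
    (G.src : ℤ) ≤ (m : ℤ) - 2 * (t : ℤ) ∧
      ((G.src : ℤ) = (m : ℤ) - 2 * (t : ℤ) ↔ G.InTriangleTreeClass t) := by
  obtain ⟨T, rfl, hT, hdisj⟩ := ht
  obtain ⟨P, hPm, hcard, hcard3, hTP⟩ := SimpleGraph.exists_edgeCliquePartition hT hdisj
  have hle := P.src_le hG
  refine ⟨by omega, fun h => ?_, fun h => ?_⟩
  · exact hG.inTriangleTreeClass_of_src_eq hT P (by omega) hcard hcard3 hTP
  · have := h.card_edgeFinset_le
    omega
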